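/- For a formal power series $g(q)=\sum_{n\ge 0}c(n)q^n$ write $c(g;n)=c(n)$. Let $$\nu^{(3)}(q)=\sum_{n=0}^{\infty}\frac{q^{n(n+1)}}{(-q;q^2)_{n+1}},\qquad (-q;q^2)_{n+1}=\prod_{i=0}^{n}\left(1+q^{2i+1}\right),$$ be the third order mock theta function $\nu^{(3)}$, regarded as a formal power series with integer coefficients, and let $a_3(n)$ be the number of $3$-core partitions of $n$, i.e. partitions of $n$ none of whose hook lengths is divisible by $3$. Then for every integer $n\ge 0$ we have $c(\nu^{(3)};n)\equiv a_3(n) \pmod 2$, and $c(\nu^{(3)};n)$ is odd if and only if $3n+1=k^2$ for some integer $k$. Moreover, for every integer $N\ge 0$, $$\#\left\{0\le n\le N : c(\nu^{(3)};n)\equiv 1 \pmod 2\right\}=\left\lfloor\sqrt{3N+1}\right\rfloor-\left\lfloor\frac{\sqrt{3N+1}}{3}\right\rfloor .$$ -/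

import Mathlib

open scoped PowerSeries PowerSeries.WithPiTopology

/-- The finite `q`-Pochhammer symbol `(a; q)_n = ∏_{i < n} (1 - a q ^ i)`. -/
def qPoch {R : Type*} [CommRing R] (a q : R) (n : ℕ) : R :=
  ∏ i ∈ Finset.range n, (1 - a * q ^ i)

/-- The `n`-th term `q ^ (n (n + 1)) / (-q; q ^ 2)_{n + 1}` of the Eulerian series of `ν⁽³⁾(q)`,
as a formal power series in `q = X` over `ℤ`.  The denominator has constant term `1`, so it is
invertible in `ℤ⟦X⟧` (see `isUnit_qPoch_nu`). -/
noncomputable def nu3Term (n : ℕ) : ℤ⟦X⟧ :=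
  PowerSeries.X ^ (n * (n + 1)) *
    Ring.inverse (qPoch (-PowerSeries.X : ℤ⟦X⟧) (PowerSeries.X ^ 2) (n + 1))

/-- The third order mock theta function
`ν⁽³⁾(q) = ∑_{n ≥ 0} q ^ (n (n + 1)) / (-q; q ^ 2)_{n + 1}` as a formal power series over `ℤ`.
The sum converges coefficientwise (see `hasSum_nu3`). -/
noncomputable def nu3 : ℤ⟦X⟧ := ∑' n : ℕ, nu3Term n

theorem isUnit_qPoch_nu (n : ℕ) :
    IsUnit (qPoch (-PowerSeries.X : ℤ⟦X⟧) (PowerSeries.X ^ 2) n) := by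
  rw [PowerSeries.isUnit_iff_constantCoeff]
  simp [qPoch, map_prod]

theorem coeff_nu3Term_eq_zero {d n : ℕ} (h : d < n) : PowerSeries.coeff d (nu3Term n) = 0 := by
  rw [nu3Term, PowerSeries.coeff_X_pow_mul', if_neg]
  nlinarith

theorem hasSum_nu3 : HasSum nu3Term nu3 := by
  refine Summable.hasSum ⟨PowerSeries.mk fun d =>
    ∑ n ∈ Finset.range (d + 1), PowerSeries.coeff d (nu3Term n), ?_⟩
  rw [PowerSeries.WithPiTopology.hasSum_iff_hasSum_coeff]
  intro d
  rw [PowerSeries.coeff_mk]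
  refine hasSum_sum_of_ne_finset_zero (f := fun n => PowerSeries.coeff d (nu3Term n))
    (s := Finset.range (d + 1)) fun n hn => coeff_nu3Term_eq_zero ?_
  rw [Finset.mem_range] at hn
  omega

/-- The hook length `arm + leg + 1` of the cell in row `i` and column `j` of a Young diagram
(rows and columns are numbered from `0`; meaningful for cells of the diagram). -/
def YoungDiagram.hookLength (μ : YoungDiagram) (i j : ℕ) : ℕ :=
  (μ.rowLen i - (j + 1)) + (μ.colLen j - (i + 1)) + 1

/-- The Young (Ferrers) diagram of a partition, whose row lengths are the parts in weakly
decreasing order. -/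
def Nat.Partition.youngDiagram {n : ℕ} (p : n.Partition) : YoungDiagram :=
  YoungDiagram.ofRowLens (p.parts.sort (· ≥ ·)) (Multiset.pairwise_sort _ _).sortedGE

/-- A partition is a `t`-core if none of the hook lengths of its diagram is divisible by `t`. -/
def Nat.Partition.IsCore {n : ℕ} (t : ℕ) (p : n.Partition) : Prop :=
  ∀ i j : ℕ, (i, j) ∈ p.youngDiagram → ¬ t ∣ p.youngDiagram.hookLength i j

/-- The number `a_t(n)` of `t`-core partitions of `n`. -/
noncomputable def numCores (t n : ℕ) : ℕ := Nat.card {p : n.Partition // p.IsCore t}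

/-! Both parities are governed by the exponents `3m² + 2m` and `3m² + 4m + 1`, `m ≥ 0`. Modulo 2 the
terms of `ν⁽³⁾` may be given signs `(-1)ⁿ`. The signed series is a limiting Fine function, and two
functional equations (`one_sub_mul_fineSum`, `fineSum_eq_one_add`) turn it into Rogers' false theta
series `∑ q^(3m²+2m) (1 - q^(2m+1))`, whose exponents are distinct. On the other side, conjugation
is an involution on `3`-cores, so only self-conjugate ones matter modulo 2; these are rigid
staircases whose sizes are the same exponents (`isCore_three_and_transpose_eq_iff`). Finally `3n +
1` equals `(3m+1)²` or `(3m+2)²` at these exponents, so counting them means counting `k ≤ √(3N+1)`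
prime to 3. -/

theorem PowerSeries.hasSum_mk_of_coeff_eq_zero {f : ℕ → ℤ⟦X⟧}
    (hf : ∀ d n, d < n → PowerSeries.coeff d (f n) = 0) :
    HasSum f (PowerSeries.mk fun d => ∑ n ∈ Finset.range (d + 1), PowerSeries.coeff d (f n)) := by
  rw [PowerSeries.WithPiTopology.hasSum_iff_hasSum_coeff]
  intro d
  rw [PowerSeries.coeff_mk]
  refine hasSum_sum_of_ne_finset_zero (f := fun n => PowerSeries.coeff d (f n))
    (s := Finset.range (d + 1)) fun n hn => hf d n ?_
  rw [Finset.mem_range] at hn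
  omega

theorem PowerSeries.coeff_tsum_of_coeff_eq_zero {f : ℕ → ℤ⟦X⟧}
    (hf : ∀ d n, d < n → PowerSeries.coeff d (f n) = 0) (d : ℕ) :
    PowerSeries.coeff d (∑' n, f n) =
      ∑ n ∈ Finset.range (d + 1), PowerSeries.coeff d (f n) := by
  rw [(PowerSeries.hasSum_mk_of_coeff_eq_zero hf).tsum_eq, PowerSeries.coeff_mk]

/-! ### Fine's function and Rogers' false theta series -/

theorem qPoch_succ {R : Type*} [CommRing R] (a q : R) (n : ℕ) :
    qPoch a q (n + 1) = qPoch a q n * (1 - a * q ^ n) :=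
  Finset.prod_range_succ _ _

theorem qPoch_succ' {R : Type*} [CommRing R] (a q : R) (n : ℕ) :
    qPoch a q (n + 1) = (1 - a) * qPoch (a * q) q n := by
  rw [qPoch, Finset.prod_range_succ', mul_comm, qPoch]
  simp only [pow_zero, mul_one, pow_succ', mul_assoc]

theorem isUnit_qPoch {b : ℤ⟦X⟧} (hb : PowerSeries.X ∣ b) (q : ℤ⟦X⟧) (n : ℕ) :
    IsUnit (qPoch b q n) := by
  rw [PowerSeries.X_dvd_iff] at hb
  rw [PowerSeries.isUnit_iff_constantCoeff]
  simp [qPoch, map_prod, hb]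

theorem isUnit_one_sub {b : ℤ⟦X⟧} (hb : PowerSeries.X ∣ b) : IsUnit (1 - b) := by
  simpa [qPoch] using isUnit_qPoch hb 1 1

/-- The `n`-th term of the series `∑ cⁿ q ^ (n (n - 1) / 2) / (b; q)_{n + 1}`, a limiting case of
Fine's function. -/
noncomputable def fineTerm (q c b : ℤ⟦X⟧) (n : ℕ) : ℤ⟦X⟧ :=
  c ^ n * q ^ n.choose 2 * Ring.inverse (qPoch b q (n + 1))

/-- The series `∑ cⁿ q ^ (n (n - 1) / 2) / (b; q)_{n + 1}`. -/
noncomputable def fineSum (q c b : ℤ⟦X⟧) : ℤ⟦X⟧ := ∑' n, fineTerm q c b n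

theorem coeff_fineTerm_eq_zero (q : ℤ⟦X⟧) {c : ℤ⟦X⟧} (hc : PowerSeries.X ∣ c) (b : ℤ⟦X⟧)
    (d n : ℕ) (h : d < n) : PowerSeries.coeff d (fineTerm q c b n) = 0 := by
  have : PowerSeries.X ^ n ∣ fineTerm q c b n :=
    Dvd.dvd.mul_right (Dvd.dvd.mul_right (pow_dvd_pow_of_dvd hc n) _) _
  exact PowerSeries.X_pow_dvd_iff.1 this d h

theorem summable_fineTerm (q : ℤ⟦X⟧) {c : ℤ⟦X⟧} (hc : PowerSeries.X ∣ c) (b : ℤ⟦X⟧) :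
    Summable (fineTerm q c b) :=
  (PowerSeries.hasSum_mk_of_coeff_eq_zero (coeff_fineTerm_eq_zero q hc b)).summable

theorem fineTerm_zero (q c b : ℤ⟦X⟧) : fineTerm q c b 0 = Ring.inverse (1 - b) := by
  simp [fineTerm, qPoch]

/-- The first factor of the denominator cancels; the extra `qⁿ` from the binomial exponent turns `c`
into `c * q`. -/
theorem one_sub_mul_fineTerm_succ (q c : ℤ⟦X⟧) {b : ℤ⟦X⟧} (hb : PowerSeries.X ∣ b) (n : ℕ) :
    (1 - b) * fineTerm q c b (n + 1) = c * fineTerm q (c * q) (b * q) n := by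
  have hch : (n + 1).choose 2 = n + n.choose 2 := by simp [Nat.choose_succ_succ' n 1]
  have h1 := Ring.mul_inverse_cancel _ (isUnit_one_sub hb)
  rw [fineTerm, fineTerm, qPoch_succ' b, Ring.mul_inverse_rev, hch]
  linear_combination (c * (c * q) ^ n * q ^ n.choose 2 *
    Ring.inverse (qPoch (b * q) q (n + 1))) * h1

/-- The left side carries the factor `1 - b * q ^ (n + 1)`, which cancels the last factor of the
denominator. -/
theorem fineTerm_succ_sub (q c : ℤ⟦X⟧) {b : ℤ⟦X⟧} (hb : PowerSeries.X ∣ b) (n : ℕ) :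
    fineTerm q c b (n + 1) - b * fineTerm q (c * q) b (n + 1) =
      c * fineTerm q (c * q) b n := by
  have hch : (n + 1).choose 2 = n + n.choose 2 := by simp [Nat.choose_succ_succ' n 1]
  have h1 := Ring.mul_inverse_cancel _ (isUnit_one_sub (hb.mul_right (q ^ (n + 1))))
  rw [fineTerm, fineTerm, fineTerm, qPoch_succ b q (n + 1), Ring.mul_inverse_rev, hch]
  linear_combination (c * (c * q) ^ n * q ^ n.choose 2 *
    Ring.inverse (qPoch b q (n + 1))) * h1

theorem one_sub_mul_fineSum (q : ℤ⟦X⟧) {b c : ℤ⟦X⟧} (hb : PowerSeries.X ∣ b)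
    (hc : PowerSeries.X ∣ c) :
    (1 - b) * fineSum q c b = 1 + c * fineSum q (c * q) (b * q) := by
  have hs := summable_fineTerm q hc b
  have hs' := summable_fineTerm q (hc.mul_right q) (b * q)
  rw [fineSum, fineSum, ← hs'.tsum_mul_left, ← hs.tsum_mul_left,
    (hs.mul_left _).tsum_eq_zero_add, fineTerm_zero,
    Ring.mul_inverse_cancel _ (isUnit_one_sub hb)]
  simp only [one_sub_mul_fineTerm_succ q c hb]

theorem fineSum_eq_one_add (q : ℤ⟦X⟧) {b c : ℤ⟦X⟧} (hb : PowerSeries.X ∣ b)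
    (hc : PowerSeries.X ∣ c) :
    fineSum q c b = 1 + (b + c) * fineSum q (c * q) b := by
  have hs := summable_fineTerm q hc b
  have hs' := summable_fineTerm q (hc.mul_right q) b
  have h : fineSum q c b - b * fineSum q (c * q) b = 1 + c * fineSum q (c * q) b := by
    rw [fineSum, fineSum, ← hs'.tsum_mul_left, ← hs'.tsum_mul_left,
      ← hs.tsum_sub (hs'.mul_left _), (hs.sub (hs'.mul_left _)).tsum_eq_zero_add]
    simp only [fineTerm_succ_sub q c hb]
    rw [fineTerm_zero, fineTerm_zero, ← one_sub_mul,
      Ring.mul_inverse_cancel _ (isUnit_one_sub hb)]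
  linear_combination h

/-- With `c = -b²` the second functional equation contributes `b q (1 - b)`, so `1 - b` divides out
and the shape `c = -b²` recurs with `b q` for `b`, ready for iteration. -/
theorem fineSum_neg_sq (q : ℤ⟦X⟧) {b : ℤ⟦X⟧} (hb : PowerSeries.X ∣ b) :
    fineSum q (-b ^ 2) b = 1 + b - b ^ 3 * q * fineSum q (-(b * q) ^ 2) (b * q) := by
  have hc : PowerSeries.X ∣ -b ^ 2 := (dvd_neg.2 (hb.trans (dvd_pow_self b two_ne_zero)))
  have h1 := one_sub_mul_fineSum q hb hc
  have h2 := fineSum_eq_one_add q (hb.mul_right q) (hc.mul_right q)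
  rw [show -b ^ 2 * q * q = -(b * q) ^ 2 by ring] at h2
  refine (isUnit_one_sub hb).mul_left_cancel ?_
  linear_combination h1 - b ^ 2 * h2

/-- Rogers' false theta expansion, after `M` steps. -/
theorem fineSum_eq_sum_add (M : ℕ) :
    fineSum (PowerSeries.X ^ 2) (-(-PowerSeries.X) ^ 2) (-PowerSeries.X) =
      ∑ m ∈ Finset.range M,
        ((PowerSeries.X : ℤ⟦X⟧) ^ (3 * m ^ 2 + 2 * m) - PowerSeries.X ^ (3 * m ^ 2 + 4 * m + 1)) +
      PowerSeries.X ^ (3 * M ^ 2 + 2 * M) *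
        fineSum (PowerSeries.X ^ 2) (-(-PowerSeries.X ^ (2 * M + 1)) ^ 2)
          (-PowerSeries.X ^ (2 * M + 1)) := by
  induction M with
  | zero => simp
  | succ M ih =>
    have h := fineSum_neg_sq (PowerSeries.X ^ 2) (b := -PowerSeries.X ^ (2 * M + 1))
      (dvd_neg.2 (dvd_pow_self _ (by omega)))
    rw [show (-PowerSeries.X ^ (2 * M + 1) * PowerSeries.X ^ 2 : ℤ⟦X⟧) =
      -PowerSeries.X ^ (2 * (M + 1) + 1) by ring] at h
    rw [ih, h, Finset.sum_range_succ]
    ring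

theorem coeff_fineSum (d : ℕ) :
    PowerSeries.coeff d
      (fineSum (PowerSeries.X ^ 2) (-(-PowerSeries.X) ^ 2) (-PowerSeries.X)) =
      ∑ m ∈ Finset.range (d + 1),
        ((if d = 3 * m ^ 2 + 2 * m then (1 : ℤ) else 0) -
          if d = 3 * m ^ 2 + 4 * m + 1 then 1 else 0) := by
  -- After `d + 1` steps the remainder has order greater than `d`.
  rw [fineSum_eq_sum_add (d + 1), map_add, PowerSeries.coeff_X_pow_mul', if_neg (by nlinarith),
    add_zero, map_sum]
  simp only [map_sub, PowerSeries.coeff_X_pow]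

/-! ### Parity of the coefficients of `ν⁽³⁾` -/

theorem fineTerm_eq_neg_one_pow_mul_nu3Term (n : ℕ) :
    fineTerm (PowerSeries.X ^ 2) (-(-PowerSeries.X) ^ 2) (-PowerSeries.X) n =
      (-1) ^ n * nu3Term n := by
  have h : n * (n + 1) = 2 * n + 2 * n.choose 2 := by
    induction n with
    | zero => rfl
    | succ n ih =>
      have hch : (n + 1).choose 2 = n + n.choose 2 := by simp [Nat.choose_succ_succ' n 1]
      rw [hch]
      linarith
  rw [fineTerm, nu3Term, h, pow_add, pow_mul, pow_mul]
  rw [show (-(-PowerSeries.X) ^ 2 : ℤ⟦X⟧) = -1 * PowerSeries.X ^ 2 by ring, mul_pow]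
  ring

theorem coeff_nu3_modEq (d : ℕ) :
    PowerSeries.coeff d nu3 ≡ PowerSeries.coeff d
      (fineSum (PowerSeries.X ^ 2) (-(-PowerSeries.X) ^ 2) (-PowerSeries.X)) [ZMOD 2] := by
  rw [nu3, fineSum, PowerSeries.coeff_tsum_of_coeff_eq_zero fun d n => coeff_nu3Term_eq_zero,
    PowerSeries.coeff_tsum_of_coeff_eq_zero (coeff_fineTerm_eq_zero _
      (dvd_neg.2 (dvd_pow (dvd_neg.2 dvd_rfl) two_ne_zero)) _)]
  refine Int.ModEq.sum fun n _ => ?_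
  rw [fineTerm_eq_neg_one_pow_mul_nu3Term]
  rcases neg_one_pow_eq_or ℤ⟦X⟧ n with h | h <;> rw [h]
  · rw [one_mul]
  · rw [neg_one_mul, map_neg]
    exact (Int.modEq_iff_dvd.2 ⟨-PowerSeries.coeff d (nu3Term n), by ring⟩)

/-- The two families of exponents interlace, so no exponent repeats. -/
theorem three_mul_sq_add_lt {a b : ℕ} (hab : a < b) :
    3 * a ^ 2 + 4 * a + 1 < 3 * b ^ 2 + 2 * b := by
  nlinarith

/-- The coefficient of `X ^ d` in `ν⁽³⁾` is odd exactly when `d` is of the form `3 m ^ 2 ± 2 m`. -/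
theorem odd_coeff_nu3_iff (d : ℕ) :
    Odd (PowerSeries.coeff d nu3) ↔
      ∃ m : ℕ, d = 3 * m ^ 2 + 2 * m ∨ d = 3 * m ^ 2 + 4 * m + 1 := by
  have hpar : Odd (PowerSeries.coeff d nu3) ↔ Odd (∑ m ∈ Finset.range (d + 1),
        ((if d = 3 * m ^ 2 + 2 * m then (1 : ℤ) else 0) -
          if d = 3 * m ^ 2 + 4 * m + 1 then 1 else 0)) := by
    rw [← coeff_fineSum, Int.odd_iff, Int.odd_iff, coeff_nu3_modEq d]
  rw [hpar]
  constructor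
  · intro h
    by_contra! hd
    refine absurd h ?_
    rw [Finset.sum_eq_zero fun m _ => by rw [if_neg (hd m).1, if_neg (hd m).2, sub_zero]]
    decide
  · rintro ⟨m, h⟩
    rw [Finset.sum_eq_single_of_mem m (Finset.mem_range.2 (by rcases h with h | h <;> nlinarith))]
    · rcases h with h | h
      · rw [if_pos h, if_neg (by nlinarith)]
        decide
      · rw [if_neg (by nlinarith), if_pos h]
        decide
    · intro k _ hk
      rw [if_neg, if_neg, sub_zero]
      all_goals
        rcases lt_or_gt_of_ne hk with hk | hk
        · have := three_mul_sq_add_lt hk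
          omega
        · have := three_mul_sq_add_lt hk
          omega

/-! ### Cores as Young diagrams, and conjugation -/

namespace YoungDiagram

theorem sum_rowLens (μ : YoungDiagram) : μ.rowLens.sum = μ.card := by
  have h : ∀ c ∈ μ.cells, c.1 ∈ Finset.range (μ.colLen 0) := by
    rintro ⟨i, j⟩ hc
    exact Finset.mem_range.2 (mem_iff_lt_colLen.1 (μ.up_left_mem le_rfl j.zero_le hc))
  rw [YoungDiagram.card, Finset.card_eq_sum_card_fiberwise h, rowLens]
  change ∑ i ∈ Finset.range (μ.colLen 0), μ.rowLen i = _
  exact Finset.sum_congr rfl fun i _ => μ.rowLen_eq_card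

/-- A Young diagram is a `t`-core if none of its hook lengths is divisible by `t`. -/
def IsCore (t : ℕ) (μ : YoungDiagram) : Prop :=
  ∀ i j : ℕ, (i, j) ∈ μ → ¬ t ∣ μ.hookLength i j

theorem hookLength_transpose (μ : YoungDiagram) (i j : ℕ) :
    μ.transpose.hookLength i j = μ.hookLength j i := by
  rw [hookLength, hookLength, rowLen_transpose, colLen_transpose]
  omega

theorem IsCore.transpose {t : ℕ} {μ : YoungDiagram} (h : μ.IsCore t) : μ.transpose.IsCore t := by
  intro i j hij
  rw [hookLength_transpose]
  exact h j i (mem_transpose.1 hij)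

theorem card_transpose (μ : YoungDiagram) : μ.transpose.card = μ.card := by
  simp [YoungDiagram.card, YoungDiagram.transpose]

end YoungDiagram

namespace Nat.Partition

theorem rowLens_youngDiagram {n : ℕ} (p : n.Partition) :
    p.youngDiagram.rowLens = p.parts.sort (· ≥ ·) :=
  YoungDiagram.rowLens_ofRowLens_eq_self fun _ hx => p.parts_pos ((Multiset.mem_sort _).1 hx)

theorem card_youngDiagram {n : ℕ} (p : n.Partition) : p.youngDiagram.card = n := by
  rw [← YoungDiagram.sum_rowLens, rowLens_youngDiagram, ← Multiset.sum_coe, Multiset.sort_eq,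
    p.parts_sum]

/-- Partitions of `n` correspond to Young diagrams with `n` cells. -/
noncomputable def equivYoungDiagram (n : ℕ) : n.Partition ≃ {μ : YoungDiagram // μ.card = n} :=
  Equiv.ofBijective (fun p => ⟨p.youngDiagram, p.card_youngDiagram⟩) <| by
    constructor
    · intro p p' h
      have h' := congrArg (fun μ => (μ.1.rowLens : Multiset ℕ)) h
      simp only [rowLens_youngDiagram, Multiset.sort_eq] at h'
      exact Nat.Partition.ext h'
    · rintro ⟨μ, hμ⟩
      refine ⟨⟨μ.rowLens, fun {i} hi => μ.pos_of_mem_rowLens i hi, ?_⟩, Subtype.ext ?_⟩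
      · rw [Multiset.sum_coe, μ.sum_rowLens, hμ]
      · apply YoungDiagram.equivListRowLens.injective
        refine Subtype.ext ?_
        simp only [YoungDiagram.equivListRowLens_apply_coe, rowLens_youngDiagram]
        exact List.Perm.eq_of_pairwise (fun _ _ _ _ h h' => le_antisymm h' h)
          (Multiset.pairwise_sort _ _) μ.rowLens_sorted.pairwise
          (Multiset.coe_eq_coe.1 (Multiset.sort_eq _ _))

/-- Partitions of `n` that are `t`-cores correspond to Young diagrams with `n` cells that are
`t`-cores. -/
noncomputable def equivCoreDiagram (t n : ℕ) :
    {p : n.Partition // p.IsCore t} ≃ {μ : YoungDiagram // μ.card = n ∧ μ.IsCore t} :=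
  ((equivYoungDiagram n).subtypeEquiv (q := fun μ => μ.1.IsCore t) fun _ => Iff.rfl).trans
    (Equiv.subtypeSubtypeEquivSubtypeInter (fun μ : YoungDiagram => μ.card = n) _)

end Nat.Partition

/-- Conjugation preserves cores, so the number of cores has the parity of the number of
self-conjugate cores. -/
theorem numCores_modEq (t n : ℕ) :
    numCores t n ≡
      Set.ncard {μ : YoungDiagram | (μ.card = n ∧ μ.IsCore t) ∧ μ.transpose = μ} [MOD 2] := by
  classical
  let α := {μ : YoungDiagram // μ.card = n ∧ μ.IsCore t}
  have : Fintype α := Fintype.ofEquiv _ (Nat.Partition.equivCoreDiagram t n)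
  let f : Function.End α :=
    fun μ => ⟨μ.1.transpose, μ.1.card_transpose.trans μ.2.1, μ.2.2.transpose⟩
  -- A map of order dividing a power of 2 has as many fixed points, modulo 2, as there are elements.
  have hf : f ^ 2 ^ 1 = 1 := by
    funext μ
    exact Subtype.ext μ.1.transpose_transpose
  have h := Equiv.Perm.card_fixedPoints_modEq hf
  rw [numCores, Nat.card_congr (Nat.Partition.equivCoreDiagram t n), Nat.card_eq_fintype_card]
  convert h using 1
  rw [← Nat.card_eq_fintype_card, ← Nat.card_coe_set_eq]
  refine Nat.card_congr ((Equiv.subtypeSubtypeEquivSubtypeInter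
    (fun μ : YoungDiagram => μ.card = n ∧ μ.IsCore t) fun μ => μ.transpose = μ).symm.trans
    (Equiv.subtypeEquivRight fun μ => ?_))
  exact (Subtype.ext_iff (a1 := f μ) (a2 := μ)).symm

/-! ### Classification of self-conjugate `3`-cores -/

namespace YoungDiagram

/-- The self-conjugate diagram whose diagonal cells have arms `d - 1, d - 4, d - 7, …`. -/
def selfConjStair (d : ℕ) : YoungDiagram where
  cells := {c ∈ Finset.range d ×ˢ Finset.range d | c.1 + c.2 + min c.1 c.2 < d}
  isLowerSet := by
    rintro ⟨i, j⟩ ⟨i', j'⟩ ⟨hi : i' ≤ i, hj : j' ≤ j⟩ h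
    simp only [Finset.coe_filter, Finset.mem_product, Finset.mem_range, Set.mem_ofPred_eq] at h ⊢
    omega

theorem mem_selfConjStair {d i j : ℕ} : (i, j) ∈ selfConjStair d ↔ i + j + min i j < d := by
  rw [← mem_cells, selfConjStair, Finset.mem_filter, Finset.mem_product, Finset.mem_range,
    Finset.mem_range]
  dsimp only
  omega

theorem transpose_selfConjStair (d : ℕ) : (selfConjStair d).transpose = selfConjStair d := by
  ext ⟨i, j⟩
  rw [mem_cells, mem_cells, mem_transpose, Prod.swap_prod_mk, mem_selfConjStair,
    mem_selfConjStair, min_comm, add_comm j i]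

theorem rowLen_eq_of_forall {μ : YoungDiagram} {i r : ℕ} (h : ∀ j, (i, j) ∈ μ ↔ j < r) :
    μ.rowLen i = r :=
  eq_of_forall_lt_iff fun j => mem_iff_lt_rowLen.symm.trans (h j)

theorem rowLen_selfConjStair (d i : ℕ) :
    (selfConjStair d).rowLen i = if 3 * i < d then d - 2 * i else (d - i + 1) / 2 := by
  refine rowLen_eq_of_forall fun j => ?_
  rw [mem_selfConjStair]
  split_ifs <;> omega

theorem colLen_eq_rowLen {μ : YoungDiagram} (h : μ.transpose = μ) (i : ℕ) :
    μ.colLen i = μ.rowLen i := by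
  rw [← rowLen_transpose, h]

/-- If `(i, i)` and `(j, j)` both lie in the diagram, the hook is `2d - 1 - 3(i + j)`, divisible by
3 only for `d ≡ 2`. If only `(i, i)` does, it is `e + ⌈e/2⌉ - 3i - 1` with `e = d - j`, never
divisible by 3. -/
theorem isCore_selfConjStair {d : ℕ} (hd : d % 3 ≠ 2) : (selfConjStair d).IsCore 3 := by
  intro i j hij
  rw [hookLength, colLen_eq_rowLen (transpose_selfConjStair d), rowLen_selfConjStair,
    rowLen_selfConjStair]
  rw [mem_selfConjStair] at hij
  split_ifs <;> omega

/-- Removing the first row and column, a hook of `2(d + 3) - 1` cells, leaves a shifted copy of the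
smaller staircase. -/
theorem card_selfConjStair_add_three (d : ℕ) :
    (selfConjStair (d + 3)).card = (selfConjStair d).card + (2 * d + 5) := by
  have h : (selfConjStair (d + 3)).cells =
      (selfConjStair d).cells.image (Prod.map Nat.succ Nat.succ) ∪
      ({0} ×ˢ Finset.range (d + 3) ∪ Finset.Ico 1 (d + 3) ×ˢ {0}) := by
    ext ⟨i, j⟩
    simp only [mem_cells, mem_selfConjStair, Finset.mem_union, Finset.mem_image, Finset.mem_product,
      Finset.mem_singleton, Finset.mem_range, Finset.mem_Ico, Prod.exists, Prod.map_apply,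
      Prod.mk.injEq]
    constructor
    · intro hij
      rcases i with - | i
      · right; left; omega
      · rcases j with - | j
        · right; right; omega
        · exact Or.inl ⟨i, j, by omega, rfl, rfl⟩
    · rintro (⟨a, b, hab, rfl, rfl⟩ | h | h) <;> omega
  rw [YoungDiagram.card, h, Finset.card_union_of_disjoint, Finset.card_union_of_disjoint,
    Finset.card_image_of_injective _ (Nat.succ_injective.prodMap Nat.succ_injective)]
  · simp
    omega
  · rw [Finset.disjoint_left]
    rintro ⟨i, j⟩ h1 h2
    simp only [Finset.mem_product, Finset.mem_singleton, Finset.mem_Ico] at h1 h2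
    omega
  · rw [Finset.disjoint_left]
    rintro ⟨i, j⟩ h1 h2
    simp only [Finset.mem_image, Prod.exists, Prod.map_apply, Prod.mk.injEq,
      Finset.mem_union, Finset.mem_product, Finset.mem_singleton] at h1 h2
    obtain ⟨a, b, -, ha, hb⟩ := h1
    omega

theorem card_selfConjStair_three_mul (m : ℕ) :
    (selfConjStair (3 * m)).card = 3 * m ^ 2 + 2 * m := by
  induction m with
  | zero => rfl
  | succ m ih =>
    rw [mul_add, mul_one, card_selfConjStair_add_three, ih]
    ring

theorem card_selfConjStair_three_mul_add_one (m : ℕ) :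
    (selfConjStair (3 * m + 1)).card = 3 * m ^ 2 + 4 * m + 1 := by
  induction m with
  | zero => rfl
  | succ m ih =>
    rw [show 3 * (m + 1) + 1 = 3 * m + 1 + 3 by ring, card_selfConjStair_add_three, ih]
    ring

/-- After a drop of 3 or more, the third cell from the end of row `i` would have arm 2, leg 0 and
hook length 3. -/
theorem rowLen_le_rowLen_succ_add_two {μ : YoungDiagram} (hμ : μ.IsCore 3) (i : ℕ) :
    μ.rowLen i ≤ μ.rowLen (i + 1) + 2 := by
  by_contra! h
  have h1 : (i, μ.rowLen i - 3) ∈ μ := mem_iff_lt_rowLen.2 (by omega)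
  have h2 : (i + 1, μ.rowLen i - 3) ∉ μ := fun h' => by
    rw [mem_iff_lt_rowLen] at h'
    omega
  refine hμ _ _ h1 ?_
  rw [mem_iff_lt_colLen] at h1 h2
  rw [hookLength]
  omega

theorem lt_rowLen_and_hook_mod_three_ne {μ : YoungDiagram} (hμ : μ.IsCore 3) (hs : μ.transpose = μ)
    {i j : ℕ} (hij : j < μ.rowLen i) :
    i < μ.rowLen j ∧ (μ.rowLen i + μ.rowLen j - i - j) % 3 ≠ 1 := by
  have h := hμ i j (mem_iff_lt_rowLen.2 hij)
  have h' := mem_iff_lt_colLen.1 (mem_iff_lt_rowLen.2 hij)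
  rw [hookLength, colLen_eq_rowLen hs] at h
  rw [colLen_eq_rowLen hs] at h'
  omega

/-- While the diagonal stays inside, rows shrink by exactly 2: larger drops are already excluded,
and the hooks at `(i, i)`, `(i, i + 1)`, `(i + 1, i + 1)` modulo 3 exclude drops 0 and 1. Beyond it,
`rowLen i ≤ i` suffices, as symmetry determines the cells below the diagonal. -/
theorem rowLen_of_isCore {μ : YoungDiagram} (hμ : μ.IsCore 3) (hs : μ.transpose = μ) (i : ℕ) :
    if 3 * i < μ.rowLen 0 then μ.rowLen i + 2 * i = μ.rowLen 0 else μ.rowLen i ≤ i := by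
  induction i with
  | zero => split_ifs <;> omega
  | succ i ih =>
    have h0 := μ.rowLen_anti i (i + 1) (by omega)
    have h1 := rowLen_le_rowLen_succ_add_two hμ i
    split_ifs at ih with hi
    · have h2 := lt_rowLen_and_hook_mod_three_ne hμ hs (i := i) (j := i)
      have h3 := lt_rowLen_and_hook_mod_three_ne hμ hs (i := i) (j := i + 1)
      have h4 := lt_rowLen_and_hook_mod_three_ne hμ hs (i := i + 1) (j := i + 1)
      split_ifs <;> omega
    · rw [if_neg (by omega)]
      omega

theorem eq_selfConjStair {μ : YoungDiagram} (hμ : μ.IsCore 3) (hs : μ.transpose = μ) :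
    μ = selfConjStair (μ.rowLen 0) := by
  have key : ∀ i j, i ≤ j → ((i, j) ∈ μ ↔ (i, j) ∈ selfConjStair (μ.rowLen 0)) := by
    intro i j hij
    have h := rowLen_of_isCore hμ hs i
    rw [mem_selfConjStair, mem_iff_lt_rowLen]
    split_ifs at h <;> omega
  ext ⟨i, j⟩
  rw [mem_cells, mem_cells]
  rcases le_total i j with h | h
  · exact key i j h
  · rw [← hs, ← transpose_selfConjStair, mem_transpose, mem_transpose, hs]
    exact key j i h

theorem rowLen_zero_mod_three {μ : YoungDiagram} (hμ : μ.IsCore 3) (hs : μ.transpose = μ) :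
    μ.rowLen 0 % 3 ≠ 2 := by
  have h := lt_rowLen_and_hook_mod_three_ne hμ hs (i := 0) (j := 0)
  omega

/-- The self-conjugate `3`-cores. -/
theorem isCore_three_and_transpose_eq_iff {μ : YoungDiagram} :
    μ.IsCore 3 ∧ μ.transpose = μ ↔
      ∃ m, μ = selfConjStair (3 * m) ∨ μ = selfConjStair (3 * m + 1) := by
  constructor
  · rintro ⟨hμ, hs⟩
    have h := rowLen_zero_mod_three hμ hs
    rw [eq_selfConjStair hμ hs]
    refine ⟨μ.rowLen 0 / 3, ?_⟩
    rcases (by omega : μ.rowLen 0 = 3 * (μ.rowLen 0 / 3) ∨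
      μ.rowLen 0 = 3 * (μ.rowLen 0 / 3) + 1) with h | h
    · exact Or.inl (congrArg _ h)
    · exact Or.inr (congrArg _ h)
  · rintro ⟨m, rfl | rfl⟩
    · exact ⟨isCore_selfConjStair (by omega), transpose_selfConjStair _⟩
    · exact ⟨isCore_selfConjStair (by omega), transpose_selfConjStair _⟩

end YoungDiagram

theorem selfConjStair_three_core_unique {n m k : ℕ} {μ ν : YoungDiagram}
    (hμ : μ = .selfConjStair (3 * m) ∨ μ = .selfConjStair (3 * m + 1))
    (hν : ν = .selfConjStair (3 * k) ∨ ν = .selfConjStair (3 * k + 1))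
    (hμn : μ.card = n) (hνn : ν.card = n) : μ = ν := by
  have h1 : m = k := by
    by_contra hmk
    rcases lt_or_gt_of_ne hmk with h | h <;> have := three_mul_sq_add_lt h <;>
    rcases hμ with rfl | rfl <;> rcases hν with rfl | rfl <;>
    simp only [YoungDiagram.card_selfConjStair_three_mul,
      YoungDiagram.card_selfConjStair_three_mul_add_one] at hμn hνn <;> omega
  subst h1
  rcases hμ with rfl | rfl <;> rcases hν with rfl | rfl <;>
    simp only [YoungDiagram.card_selfConjStair_three_mul,
      YoungDiagram.card_selfConjStair_three_mul_add_one] at hμn hνn <;> first | rfl | omega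

theorem odd_numCores_three_iff (n : ℕ) :
    Odd (numCores 3 n) ↔ ∃ m : ℕ, n = 3 * m ^ 2 + 2 * m ∨ n = 3 * m ^ 2 + 4 * m + 1 := by
  rw [Nat.odd_iff, numCores_modEq 3 n]
  simp only [and_assoc, YoungDiagram.isCore_three_and_transpose_eq_iff]
  set S := {μ : YoungDiagram | μ.card = n ∧
    ∃ m, μ = .selfConjStair (3 * m) ∨ μ = .selfConjStair (3 * m + 1)} with hS
  have hsub : S.Subsingleton := by
    rintro μ ⟨hμn, m, hμ⟩ ν ⟨hνn, k, hν⟩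
    exact selfConjStair_three_core_unique hμ hν hμn hνn
  have hne : S.Nonempty ↔ ∃ m : ℕ, n = 3 * m ^ 2 + 2 * m ∨ n = 3 * m ^ 2 + 4 * m + 1 := by
    constructor
    · rintro ⟨μ, hμn, m, rfl | rfl⟩
      · exact ⟨m, Or.inl (by rw [← hμn, YoungDiagram.card_selfConjStair_three_mul])⟩
      · exact ⟨m, Or.inr (by rw [← hμn, YoungDiagram.card_selfConjStair_three_mul_add_one])⟩
    · rintro ⟨m, rfl | rfl⟩
      · exact ⟨_, YoungDiagram.card_selfConjStair_three_mul m, m, Or.inl rfl⟩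
      · exact ⟨_, YoungDiagram.card_selfConjStair_three_mul_add_one m, m, Or.inr rfl⟩
  rw [← hne]
  rcases hsub.eq_empty_or_singleton with h | ⟨μ, h⟩ <;> rw [h] <;> simp

/-! ### Squares of the form `3n + 1` and their count -/

theorem exists_exponent_iff_exists_sq (n : ℕ) :
    (∃ m : ℕ, n = 3 * m ^ 2 + 2 * m ∨ n = 3 * m ^ 2 + 4 * m + 1) ↔
      ∃ k : ℕ, 3 * n + 1 = k ^ 2 := by
  constructor
  · rintro ⟨m, rfl | rfl⟩
    · exact ⟨3 * m + 1, by ring⟩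
    · exact ⟨3 * m + 2, by ring⟩
  · rintro ⟨k, hk⟩
    obtain ⟨m, rfl | rfl | rfl⟩ : ∃ m, k = 3 * m ∨ k = 3 * m + 1 ∨ k = 3 * m + 2 :=
      ⟨k / 3, by omega⟩
    · ring_nf at hk
      omega
    · exact ⟨m, Or.inl (by linarith)⟩
    · exact ⟨m, Or.inr (by linarith)⟩

theorem ncard_three_mul_add_one_eq_sq (N : ℕ) :
    (Set.ncard {n : ℕ | n ≤ N ∧ ∃ k : ℕ, 3 * n + 1 = k ^ 2}) + Nat.sqrt (3 * N + 1) / 3 =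
      Nat.sqrt (3 * N + 1) := by
  set K := Nat.sqrt (3 * N + 1) with hK
  -- Such `n` are parametrised by the positive root `k` of `3n + 1`, which is prime to 3 and at most
  -- `K`.
  have hset : {n : ℕ | n ≤ N ∧ ∃ k : ℕ, 3 * n + 1 = k ^ 2} =
      (fun k => (k ^ 2 - 1) / 3) '' ({k ∈ Finset.Ioc 0 K | ¬ 3 ∣ k} : Finset ℕ) := by
    ext n
    simp only [Set.mem_ofPred_eq, Set.mem_image, Finset.coe_filter, Finset.mem_Ioc]
    constructor
    · rintro ⟨hn, k, hk⟩
      refine ⟨k, ⟨⟨Nat.pos_of_ne_zero ?_, ?_⟩, ?_⟩, by omega⟩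
      · rintro rfl
        omega
      · rw [hK, Nat.le_sqrt', ← hk]
        omega
      · intro h
        have := dvd_pow h two_ne_zero
        omega
    · rintro ⟨k, ⟨⟨hk0, hkK⟩, hk3⟩, rfl⟩
      rw [hK, Nat.le_sqrt'] at hkK
      have h1 : k ^ 2 % 3 = 1 := by
        rw [Nat.pow_mod]
        rcases (by omega : k % 3 = 1 ∨ k % 3 = 2) with h | h <;> rw [h]
      exact ⟨by omega, k, by omega⟩
  have hinj : Set.InjOn (fun k : ℕ => (k ^ 2 - 1) / 3)
      ({k ∈ Finset.Ioc 0 K | ¬ 3 ∣ k} : Finset ℕ) := by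
    have h1 : ∀ k ∈ ({k ∈ Finset.Ioc 0 K | ¬ 3 ∣ k} : Finset ℕ), k ^ 2 % 3 = 1 := by
      intro k hk
      have := (Finset.mem_filter.1 hk).2
      rw [Nat.pow_mod]
      rcases (by omega : k % 3 = 1 ∨ k % 3 = 2) with h | h <;> rw [h]
    intro a ha b hb hab
    have ha1 := h1 a ha
    have hb1 := h1 b hb
    simp only at hab
    exact Nat.pow_left_injective two_ne_zero (by show a ^ 2 = b ^ 2; omega)
  rw [hset, hinj.ncard_image, Set.ncard_coe_finset, add_comm,
    ← Nat.Ioc_filter_dvd_card_eq_div K 3, Finset.card_filter_add_card_filter_not, Nat.card_Ioc,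
    Nat.sub_zero]

theorem mainTheorem10 :
    (∀ n : ℕ, PowerSeries.coeff n nu3 ≡ (numCores 3 n : ℤ) [ZMOD 2]) ∧
    (∀ n : ℕ, Odd (PowerSeries.coeff n nu3) ↔ ∃ k : ℤ, 3 * (n : ℤ) + 1 = k ^ 2) ∧
    (∀ N : ℕ, (Set.ncard {n : ℕ | n ≤ N ∧ PowerSeries.coeff n nu3 ≡ 1 [ZMOD 2]} : ℤ) =
      ⌊Real.sqrt (3 * (N : ℝ) + 1)⌋ - ⌊Real.sqrt (3 * (N : ℝ) + 1) / 3⌋) := by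
  have hodd : ∀ n : ℕ, Odd (PowerSeries.coeff n nu3) ↔ ∃ k : ℕ, 3 * n + 1 = k ^ 2 := fun n =>
    (odd_coeff_nu3_iff n).trans (exists_exponent_iff_exists_sq n)
  refine ⟨fun n => ?_, fun n => (hodd n).trans ⟨?_, ?_⟩, fun N => ?_⟩
  · have h : Odd (PowerSeries.coeff n nu3) ↔ Odd (numCores 3 n : ℤ) := by
      rw [Int.odd_coe_nat, odd_coeff_nu3_iff, odd_numCores_three_iff]
    rw [Int.odd_iff, Int.odd_iff] at h
    rw [Int.ModEq]
    omega
  · rintro ⟨k, hk⟩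
    exact ⟨k, by exact_mod_cast hk⟩
  · rintro ⟨k, hk⟩
    refine ⟨k.natAbs, ?_⟩
    zify
    rw [hk, sq_abs]
  · have hset : {n : ℕ | n ≤ N ∧ PowerSeries.coeff n nu3 ≡ 1 [ZMOD 2]} =
        {n : ℕ | n ≤ N ∧ ∃ k : ℕ, 3 * n + 1 = k ^ 2} := by
      ext n
      rw [Set.mem_ofPred_eq, Set.mem_ofPred_eq, ← hodd, Int.odd_iff]
      exact Iff.rfl
    have hfl : ⌊Real.sqrt (3 * (N : ℝ) + 1)⌋ = (Nat.sqrt (3 * N + 1) : ℤ) := by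
      rw [← Real.floor_real_sqrt_eq_nat_sqrt]
      push_cast
      rfl
    -- `⌊x / 3⌋ = ⌊x⌋ / 3`, so the second floor is also a quotient of the integer square root.
    have hfl3 := Int.floor_div_natCast (Real.sqrt (3 * (N : ℝ) + 1)) 3
    rw [Nat.cast_ofNat] at hfl3
    rw [hset, hfl3, hfl]
    have := ncard_three_mul_add_one_eq_sq N
    omega
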